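/- Let $\mathbb{F}$ be a field and $G$ a torsion-free group. For $\alpha=\sum_{x\in G} a_x x\in\mathbb{F}[G]$ write $\mathrm{supp}(\alpha)=\{x\in G \mid a_x\neq 0\}$. To a pair $(\alpha,\beta)$ of elements of $\mathbb{F}[G]$ associate the loopless undirected multigraph with vertex set $\mathrm{supp}(\beta)$ and edge set $$\bigl\{\{(h,h',g,g'),(h',h,g',g)\} \;\big|\; h,h'\in\mathrm{supp}(\alpha),\ g,g'\in\mathrm{supp}(\beta),\ g\neq g',\ hg=h'g'\bigr\},$$ where the edge $\{(h,h',g,g'),(h',h,g',g)\}$ joins $g$ and $g'$. This graph is called the zero-divisor graph $Z(\alpha,\beta)$ if $\alpha,\beta$ are non-zero and $\alpha\beta=0$, and the unit graph $U(\alpha,\beta)$ if $\alpha\beta=1$. Let $C_3\text{--}C_3$ denote the simple graph with four vertices formed by two triangles with exactly one edge in common, and $K_{2,3}$ the complete bipartite graph with parts of sizes $2$ and $3$. (1) Let $\alpha,\beta\in\mathbb{F}[G]$ be non-zero with $|\mathrm{supp}(\alpha)|=3$ and $\alpha\beta=0$. Then $Z(\alpha,\beta)$ has no (not necessarily induced)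 subgraph isomorphic to $C_3\text{--}C_3$ and no subgraph isomorphic to $K_{2,3}$. (2) Let $\alpha,\beta\in\mathbb{F}[G]$ with $|\mathrm{supp}(\alpha)|=3$ and $\alpha\beta=1$, and suppose that $|\mathrm{supp}(\beta')|\geq|\mathrm{supp}(\beta)|$ for every $\beta'\in\mathbb{F}[G]$ with $\alpha\beta'=1$. Then $U(\alpha,\beta)$ has no subgraph isomorphic to $C_3\text{--}C_3$ and no subgraph isomorphic to $K_{2,3}$. -/

import Mathlib

open scoped Graph

/-- The group `G` is torsion-free: no non-identity element has finite order.
(`IsMulTorsionFree` is the stronger requirement that roots are unique.) -/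
def IsTorsionFreeGroup (G : Type*) [Group G] : Prop :=
  ∀ g : G, g ≠ 1 → ¬ IsOfFinOrder g

/-- The support `supp(α) = {x ∈ G | a_x ≠ 0}` of an element `α = ∑ a_x x` of `F[G]`. -/
def gsupp {F G : Type*} [Field F] (α : MonoidAlgebra F G) : Finset G :=
  α.coeff.support

/-- The multigraph attached to a pair `(α, β)` of elements of `F[G]`. Its vertex set is `supp(β)`;
its edges are the sets `{(h, h', g, g'), (h', h, g', g)}` with `h, h' ∈ supp(α)`,
`g, g' ∈ supp(β)`, `g ≠ g'` and `h g = h' g'`; the ends of such an edge are `g` and `g'`. -/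
def pairGraph {F G : Type*} [Field F] [Group G] (α β : MonoidAlgebra F G) :
    Graph G (Set (G × G × G × G)) where
  vertexSet := {g | g ∈ gsupp β}
  IsLink e g g' := ∃ h h' : G, h ∈ gsupp α ∧ h' ∈ gsupp α ∧ g ∈ gsupp β ∧ g' ∈ gsupp β ∧
    g ≠ g' ∧ h * g = h' * g' ∧ e = {(h, h', g, g'), (h', h, g', g)}
  isLink_symm := by
    rintro e -
    refine ⟨?_⟩
    rintro g g' ⟨h, h', hh, hh', hg, hg', hne, heq, rfl⟩
    exact ⟨h', h, hh', hh, hg', hg, hne.symm, heq.symm, Set.pair_comm _ _⟩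
  eq_or_eq_of_isLink_of_isLink := by
    rintro e x y v w ⟨h, h', -, -, -, -, -, -, rfl⟩ ⟨k, k', -, -, -, -, -, -, he⟩
    have hmem : (h, h', x, y) ∈ ({(k, k', v, w), (k', k, w, v)} : Set (G × G × G × G)) :=
      he ▸ Set.mem_insert _ _
    simp only [Set.mem_insert_iff, Set.mem_singleton_iff, Prod.mk.injEq] at hmem
    tauto
  left_mem_of_isLink := by
    rintro e x y ⟨h, h', -, -, hx, -⟩
    exact hx

/-- The zero-divisor graph `Z(α, β)`, to be used for `α ≠ 0`, `β ≠ 0`, `α β = 0`. -/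
abbrev zeroDivisorGraph {F G : Type*} [Field F] [Group G] (α β : MonoidAlgebra F G) :
    Graph G (Set (G × G × G × G)) :=
  pairGraph α β

/-- The unit graph `U(α, β)`, to be used for `α β = 1`. -/
abbrev unitGraph {F G : Type*} [Field F] [Group G] (α β : MonoidAlgebra F G) :
    Graph G (Set (G × G × G × G)) :=
  pairGraph α β

/-- An isomorphism of multigraphs: a bijection of the vertex sets and a bijection of the edge sets
that respect the ends of every edge. -/
structure MultigraphIso {V₁ E₁ V₂ E₂ : Type*} (Γ : Graph V₁ E₁) (Δ : Graph V₂ E₂) where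
  vertexEquiv : V(Γ) ≃ V(Δ)
  edgeEquiv : E(Γ) ≃ E(Δ)
  isLink_iff : ∀ (e : E(Γ)) (x y : V(Γ)),
    Γ.IsLink e x y ↔ Δ.IsLink (edgeEquiv e) (vertexEquiv x) (vertexEquiv y)

/-- `Γ` has a (not necessarily induced) subgraph isomorphic to the simple graph `H`. -/
def HasSubgraphIsoTo {V E W : Type*} (Γ : Graph V E) (H : SimpleGraph W) : Prop :=
  ∃ K : Graph V E, K ≤ Γ ∧ Nonempty (MultigraphIso K (Graph.ofSimpleGraph H))

/-- The graph `C₃ – C₃`: the two triangles `0 1 2` and `0 1 3` with the common edge `0 1`. -/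
def twoTriangles : SimpleGraph (Fin 4) :=
  SimpleGraph.fromEdgeSet {s(0, 1), s(0, 2), s(1, 2), s(0, 3), s(1, 3)}

/-- The complete bipartite graph `K_{2,3}`. -/
abbrev K23 : SimpleGraph (Fin 2 ⊕ Fin 3) :=
  completeBipartiteGraph (Fin 2) (Fin 3)

/-! Let A = supp(α) and B = supp(β). A pair with a unique product ab contributes a non-zero
coefficient to αβ, so when αβ is 0 or 1, A and B cannot have two distinct unique products. Write A =
{a, ax, ay}. If x and y commute, or x inverts y, then ⟨x, y⟩ carries an integer weight not constant
on {1, x, y}, and the top and bottom layers of AB each contain a unique product. Hence A is a rigid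
triple (`isRigidTriple_gsupp`), and the rest concerns words in its three letters.

A triangle spells a closed word of length six. Rigidity and torsion-freeness leave only triangles ag
= bp = cq with a, b, c distinct (`IsRigidTriple.triangle`). An edge determines its letters
(`pair_unique`), hence also the third vertex of any triangle on it, which excludes C₃–C₃.

In a K_{2,3}, three two-step paths share the displacement g'g⁻¹. Without C₃–C₃, their first letters
are distinct, and so are their last letters. A finite check reduces this to twelve sets of word
equations (`not_three_twoStep`), each forcing x and y to commute. -/

/-! ### Unique products from integer weights -/

/-- In a torsion-free group no non-trivial left translation maps a nonempty finite set to itself. -/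
theorem IsTorsionFreeGroup.exists_mul_notMem {G : Type*} [Group G] (hG : IsTorsionFreeGroup G)
    {t : G} (ht : t ≠ 1) {B : Finset G} (hB : B.Nonempty) : ∃ b ∈ B, t * b ∉ B := by
  by_contra! h
  obtain ⟨b, hb⟩ := hB
  have hmem : ∀ n : ℕ, t ^ n * b ∈ B := by
    intro n
    induction n with
    | zero => simpa using hb
    | succ n ih => rw [pow_succ', mul_assoc]; exact h _ ih
  have hinj : Function.Injective fun n : ℕ => (⟨t ^ n * b, hmem n⟩ : B) := by
    intro m n hmn
    have : t ^ m = t ^ n := by simpa using hmn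
    exact (injective_pow_iff_not_isOfFinOrder.2 (hG t ht)) this
  exact not_injective_infinite_finite _ hinj

/-- The top layer, for a weight that is not constant on the three-element set `A`, of the product
of `A` with a finite set contains a unique product. -/
theorem IsTorsionFreeGroup.exists_uniqueMul_isMax {G : Type*} [Group G]
    (hG : IsTorsionFreeGroup G) {A B : Finset G} (hA : A.card = 3) {R : G → Prop}
    (hB : ∃ b ∈ B, R b) (f w : G → ℤ)
    (hw : ∀ a ∈ A, ∀ a' ∈ A, ∀ b b', R b → a * b = a' * b' → R b' ∧ w a + f b = w a' + f b')
    (hne : ∃ a ∈ A, ∃ a' ∈ A, w a ≠ w a') :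
    ∃ a ∈ A, ∃ b ∈ B, UniqueMul A B a b ∧ ∀ a' ∈ A, w a' ≤ w a := by
  classical
  obtain ⟨m, hmA, hm⟩ := A.exists_max_image w (Finset.card_pos.1 (by omega))
  obtain ⟨n, hnB, hn⟩ := (B.filter R).exists_max_image f
    (by obtain ⟨b, hb, hR⟩ := hB; exact ⟨b, by simp [hb, hR]⟩)
  set B' := (B.filter R).filter (fun b => f b = f n) with hB'
  have hB'ne : B'.Nonempty := ⟨n, by simp [hB', hnB]⟩
  -- Equal products have equal total weight `w + f`. Both summands are maximal at `a * b`, so they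
  -- are maximal in every other factorization.
  have key : ∀ a ∈ A, w a = w m → ∀ b ∈ B', ∀ a' ∈ A, ∀ b' ∈ B, a' * b' = a * b →
      w a' = w m ∧ b' ∈ B' := by
    intro a ha haw b hb a' ha' b' hb' h
    simp only [hB', Finset.mem_filter] at hb ⊢
    obtain ⟨hR', hs⟩ := hw a ha a' ha' b b' hb.1.2 h.symm
    have h1 := hm a' ha'
    have h2 := hn b' (by simp [hb', hR'])
    exact ⟨by omega, ⟨hb', hR'⟩, by omega⟩
  have hBB : ∀ b ∈ B', b ∈ B := fun b hb => by
    simp only [hB', Finset.mem_filter] at hb; exact hb.1.1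
  by_cases h2 : ∃ m' ∈ A, w m' = w m ∧ m' ≠ m
  · obtain ⟨m', hm'A, hm'w, hm'⟩ := h2
    have honly : ∀ a ∈ A, w a = w m → a = m ∨ a = m' := by
      intro a ha haw
      by_contra! hcon
      have hsub : ({a, m, m'} : Finset G) = A := by
        apply Finset.eq_of_subset_of_card_le
        · intro z hz
          simp only [Finset.mem_insert, Finset.mem_singleton] at hz
          rcases hz with rfl | rfl | rfl <;> assumption
        · rw [hA, Finset.card_eq_three.2 ⟨a, m, m', hcon.1, hcon.2, hm'.symm, rfl⟩]
      have : ∀ z ∈ A, w z = w m := by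
        intro z hz
        rw [← hsub] at hz
        simp only [Finset.mem_insert, Finset.mem_singleton] at hz
        rcases hz with rfl | rfl | rfl <;> first | assumption | rfl
      obtain ⟨z, hz, z', hz', hzz⟩ := hne
      exact hzz ((this z hz).trans (this z' hz').symm)
    -- Only `m` and `m'` have top weight, so the only possible collision is `m' * b = m * b'` with
    -- `b' ∈ B'`. It is avoided by a `b` that the translation by `m⁻¹ * m'` moves out of `B'`.
    obtain ⟨b, hb, hbt⟩ := hG.exists_mul_notMem (t := m⁻¹ * m')
      (fun h => hm' (by rw [inv_mul_eq_one] at h; exact h.symm)) hB'ne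
    refine ⟨m', hm'A, b, hBB b hb, ?_, fun a' ha' => hm'w ▸ hm a' ha'⟩
    intro a' b' ha' hb' h
    obtain ⟨h3, h4⟩ := key m' hm'A hm'w b hb a' ha' b' hb' h
    rcases honly a' ha' h3 with rfl | rfl
    · exact absurd (by rw [mul_assoc, ← h, inv_mul_cancel_left]; exact h4) hbt
    · exact ⟨rfl, mul_left_cancel h⟩
  · push Not at h2
    obtain ⟨b, hb⟩ := hB'ne
    refine ⟨m, hmA, b, hBB b hb, ?_, hm⟩
    intro a' b' ha' hb' h
    obtain rfl := h2 a' ha' (key m hmA rfl b hb a' ha' b' hb' h).1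
    exact ⟨rfl, mul_left_cancel h⟩

/-- A weight that is not constant on the three-element set `A` yields two distinct unique
products. -/
theorem IsTorsionFreeGroup.exists_two_uniqueMul {G : Type*} [Group G]
    (hG : IsTorsionFreeGroup G) {A B : Finset G} (hA : A.card = 3) {R : G → Prop}
    (hB : ∃ b ∈ B, R b) (f w : G → ℤ)
    (hw : ∀ a ∈ A, ∀ a' ∈ A, ∀ b b', R b → a * b = a' * b' → R b' ∧ w a + f b = w a' + f b')
    (hne : ∃ a ∈ A, ∃ a' ∈ A, w a ≠ w a') :
    ∃ a ∈ A, ∃ b ∈ B, ∃ a' ∈ A, ∃ b' ∈ B, UniqueMul A B a b ∧ UniqueMul A B a' b' ∧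
      a * b ≠ a' * b' := by
  obtain ⟨a, ha, b, hb, hu, hmax⟩ := hG.exists_uniqueMul_isMax hA hB f w hw hne
  obtain ⟨a', ha', b', hb', hu', hmin⟩ := hG.exists_uniqueMul_isMax hA hB (fun g => -f g)
    (fun g => -w g)
    (fun a ha a' ha' b b' hR h => by
      obtain ⟨h1, h2⟩ := hw a ha a' ha' b b' hR h
      exact ⟨h1, by omega⟩)
    (by
      obtain ⟨z, hz, z', hz', h⟩ := hne
      exact ⟨z, hz, z', hz', by omega⟩)
  refine ⟨a, ha, b, hb, a', ha', b', hb', hu, hu', fun h => ?_⟩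
  -- If the top and bottom products agreed, one element would have both the largest and the smallest
  -- weight, making `w` constant on `A`.
  obtain ⟨rfl, -⟩ := hu ha' hb' h.symm
  obtain ⟨z, hz, z', hz', hzz⟩ := hne
  have := hmax z hz
  have := hmax z' hz'
  have := hmin z hz
  have := hmin z' hz'
  omega

/-- Elements `x`, `y` with `x y x⁻¹ = y ^ k`, together with weights `s`, `r` of `x`, `y` that vanish
on the relations, yield two unique products for `{a, a x, a y}`. -/
theorem IsTorsionFreeGroup.exists_two_uniqueMul_of_weights {G : Type*} [Group G]
    (hG : IsTorsionFreeGroup G) {A B : Finset G} (hA : A.card = 3) (hB : B.Nonempty)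
    {a x y : G} (hAmem : ∀ z, z ∈ A ↔ z = a ∨ z = a * x ∨ z = a * y) {k r s : ℤ}
    (hk : x * y * x⁻¹ = y ^ k) (hk' : x⁻¹ * y * x = y ^ k) (hkr : k * r = r)
    (hrs : r ≠ 0 ∨ s ≠ 0)
    (hz : ∀ i j : ℤ, y ^ j * x ^ i = 1 → j * r + i * s = 0) :
    ∃ a ∈ A, ∃ b ∈ B, ∃ a' ∈ A, ∃ b' ∈ B, UniqueMul A B a b ∧ UniqueMul A B a' b' ∧
      a * b ≠ a' * b' := by
  classical
  obtain ⟨b₀, hb₀⟩ := hB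
  let R : G → Prop := fun b => ∃ i j : ℤ, b = y ^ j * x ^ i * b₀
  have hwt : ∃ f : G → ℤ, ∀ i j : ℤ, f (y ^ j * x ^ i * b₀) = j * r + i * s := by
    -- `hz` makes the weight independent of the chosen exponents. The value 0 outside `R` is never
    -- used.
    refine ⟨fun b => if h : R b then h.choose_spec.choose * r + h.choose * s else 0, ?_⟩
    intro i j
    have h : R (y ^ j * x ^ i * b₀) := ⟨i, j, rfl⟩
    simp only [dif_pos h]
    have hs := h.choose_spec.choose_spec
    set i' := h.choose
    set j' := h.choose_spec.choose
    have h1 : y ^ j * x ^ i = y ^ j' * x ^ i' := mul_right_cancel hs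
    have h2 : y ^ (j - j') * x ^ (i - i') = 1 := by
      rw [sub_eq_neg_add, zpow_add, zpow_sub, mul_assoc, ← mul_assoc (y ^ j), h1]
      group
    have := hz _ _ h2
    linarith
  obtain ⟨f, hf⟩ := hwt
  have hxy : ∀ j : ℤ, x * y ^ j = y ^ (k * j) * x := by
    intro j
    rw [zpow_mul, ← hk, conj_zpow]
    group
  have hxy' : ∀ j : ℤ, x⁻¹ * y ^ j = y ^ (k * j) * x⁻¹ := by
    intro j
    have : (x⁻¹ * y * x⁻¹⁻¹) ^ j = _ := conj_zpow
    rw [inv_inv, hk', ← zpow_mul] at this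
    rw [this]; group
  have hx : ∀ b, R b → R (x * b) ∧ f (x * b) = s + f b := by
    rintro _ ⟨i, j, rfl⟩
    have : x * (y ^ j * x ^ i * b₀) = y ^ (k * j) * x ^ (i + 1) * b₀ := by
      rw [mul_assoc, ← mul_assoc x, hxy, add_comm i, zpow_add, zpow_one]; simp only [mul_assoc]
    refine ⟨⟨_, _, this⟩, ?_⟩
    -- Moving `x` past `y ^ j` multiplies the exponent by `k`; the weight survives because `k * r =
    -- r`.
    rw [this, hf, hf, mul_right_comm, hkr]; ring
  have hx' : ∀ b, R (x * b) → R b := by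
    rintro b ⟨i, j, h⟩
    refine ⟨i - 1, k * j, ?_⟩
    rw [← inv_mul_cancel_left x b, h, mul_assoc, ← mul_assoc x⁻¹, hxy', sub_eq_neg_add, zpow_add,
      zpow_neg_one]
    simp only [mul_assoc]
  have hy : ∀ b, R b → R (y * b) ∧ f (y * b) = r + f b := by
    rintro _ ⟨i, j, rfl⟩
    have : y * (y ^ j * x ^ i * b₀) = y ^ (1 + j) * x ^ i * b₀ := by
      rw [zpow_add, zpow_one]; simp only [mul_assoc]
    refine ⟨⟨_, _, this⟩, ?_⟩
    rw [this, hf, hf]; ring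
  have hy' : ∀ b, R (y * b) → R b := by
    rintro b ⟨i, j, h⟩
    refine ⟨i, -1 + j, ?_⟩
    rw [← inv_mul_cancel_left y b, h, zpow_add, zpow_neg_one]
    simp only [mul_assoc]
  have hR₀ : R b₀ := ⟨0, 0, by simp⟩
  have hf₀ : f b₀ = 0 := by simpa using hf 0 0
  have hwx : f (x * b₀) = s := by rw [(hx _ hR₀).2, hf₀, add_zero]
  have hwy : f (y * b₀) = r := by rw [(hy _ hR₀).2, hf₀, add_zero]
  have hwA : ∀ z ∈ A, ∀ b, (R b → R (a⁻¹ * z * b) ∧ f (a⁻¹ * z * b) = f (a⁻¹ * z * b₀) + f b) ∧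
      (R (a⁻¹ * z * b) → R b) := by
    intro z hzA b
    rcases (hAmem z).1 hzA with rfl | rfl | rfl
    · simp [hf₀]
    · rw [inv_mul_cancel_left, hwx]; exact ⟨hx b, hx' b⟩
    · rw [inv_mul_cancel_left, hwy]; exact ⟨hy b, hy' b⟩
  refine hG.exists_two_uniqueMul hA (R := R) ⟨b₀, hb₀, hR₀⟩ f (fun z => f (a⁻¹ * z * b₀)) ?_ ?_
  · intro z hzA z' hz'A b b' hRb h
    have h' : a⁻¹ * z * b = a⁻¹ * z' * b' := by rw [mul_assoc, h, mul_assoc]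
    have h1 := (hwA z hzA b).1 hRb
    have h2 : R b' := (hwA z' hz'A b').2 (h' ▸ h1.1)
    refine ⟨h2, ?_⟩
    rw [← h1.2, h', ((hwA z' hz'A b').1 h2).2]
  · rcases hrs with h | h
    · exact ⟨a * y, by simp [hAmem], a, by simp [hAmem], by simpa [hwy, hf₀] using h⟩
    · exact ⟨a * x, by simp [hAmem], a, by simp [hAmem], by simpa [hwx, hf₀] using h⟩

theorem IsTorsionFreeGroup.eq_one_of_zpow {G : Type*} [Group G] (hG : IsTorsionFreeGroup G)
    {g : G} {n : ℤ} (hn : n ≠ 0) (h : g ^ n = 1) : g = 1 := by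
  by_contra hg
  exact hG g hg (isOfFinOrder_iff_zpow_eq_one.2 ⟨n, hn, h⟩)

/-- If `x` commutes with `y ≠ 1`, then `{a, a x, a y}` has two unique products with every nonempty
finite set. -/
theorem IsTorsionFreeGroup.exists_two_uniqueMul_of_commute {G : Type*} [Group G]
    (hG : IsTorsionFreeGroup G) {A B : Finset G} (hA : A.card = 3) (hB : B.Nonempty)
    {a x y : G} (hAmem : ∀ z, z ∈ A ↔ z = a ∨ z = a * x ∨ z = a * y) (hy : y ≠ 1)
    (hxy : Commute x y) :
    ∃ a ∈ A, ∃ b ∈ B, ∃ a' ∈ A, ∃ b' ∈ B, UniqueMul A B a b ∧ UniqueMul A B a' b' ∧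
      a * b ≠ a' * b' := by
  have h1 : x * y * x⁻¹ = y ^ (1 : ℤ) := by rw [hxy.eq]; simp
  have h2 : x⁻¹ * y * x = y ^ (1 : ℤ) := by rw [mul_assoc, ← hxy.eq]; simp
  by_cases h : ∃ m n : ℤ, m ≠ 0 ∧ x ^ m = y ^ n
  · obtain ⟨m, n, hm, hmn⟩ := h
    -- Weight `m` for `y` and `n` for `x` respects `x ^ m = y ^ n`: the `m`-th power of a relation
    -- `y ^ j * x ^ i = 1` is `y ^ (j * m + i * n) = 1`.
    refine hG.exists_two_uniqueMul_of_weights hA hB hAmem h1 h2 (one_mul m) (s := n) (Or.inl hm) ?_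
    intro i j hij
    by_contra hne
    apply hy
    apply hG.eq_one_of_zpow hne
    have h3 : (y ^ j * x ^ i) ^ m = 1 := by rw [hij, one_zpow]
    rw [((hxy.symm.zpow_zpow j i)).mul_zpow, ← zpow_mul x, mul_comm i, zpow_mul x, hmn,
      ← zpow_mul, ← zpow_mul, ← zpow_add] at h3
    rw [mul_comm i]; exact h3
  · push Not at h
    -- No non-zero power of `x` lies in ⟨y⟩, so the exponent of `x` is itself a weight.
    refine hG.exists_two_uniqueMul_of_weights hA hB hAmem h1 h2 (r := 0) (s := 1) (by simp)
      (by simp) ?_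
    intro i j hij
    by_contra hne
    refine h i (-j) (by simpa using hne) ?_
    rw [zpow_neg, eq_inv_of_mul_eq_one_right hij]

/-- If `x ≠ 1` inverts `y ≠ 1`, then `{a, a x, a y}` has two unique products with every nonempty
finite set. -/
theorem IsTorsionFreeGroup.exists_two_uniqueMul_of_inverts {G : Type*} [Group G]
    (hG : IsTorsionFreeGroup G) {A B : Finset G} (hA : A.card = 3) (hB : B.Nonempty)
    {a x y : G} (hAmem : ∀ z, z ∈ A ↔ z = a ∨ z = a * x ∨ z = a * y) (hx : x ≠ 1) (hy : y ≠ 1)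
    (hxy : x * y * x⁻¹ = y⁻¹) :
    ∃ a ∈ A, ∃ b ∈ B, ∃ a' ∈ A, ∃ b' ∈ B, UniqueMul A B a b ∧ UniqueMul A B a' b' ∧
      a * b ≠ a' * b' := by
  -- Here `k * r = r` forces `r = 0`, as in the Klein bottle group, so the weight counts `x` only.
  refine hG.exists_two_uniqueMul_of_weights hA hB hAmem (k := -1) (r := 0) (s := 1)
    (by simpa using hxy) ?_ (by simp) (by simp) ?_
  · rw [zpow_neg_one, ← inv_inj, inv_inv, mul_inv_rev, mul_inv_rev, inv_inv, ← hxy]; group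
  · intro i j hij
    have hi : x ^ i = y ^ (-j) := by rw [zpow_neg, eq_inv_of_mul_eq_one_right hij]
    have h1 : x * y ^ (-j) * x⁻¹ = y ^ j := by
      rw [← conj_zpow, hxy, inv_zpow, zpow_neg, inv_inv]
    rw [← hi] at h1
    have h2 : x ^ i = y ^ j := by rw [← h1]; group
    have h3 : y ^ (j + j) = 1 := by rw [zpow_add]; nth_rw 2 [← h2]; exact hij
    have h4 : j = 0 := by
      by_contra hj
      exact hy (hG.eq_one_of_zpow (by omega) h3)
    subst h4
    have h5 : i = 0 := by
      by_contra hi0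
      exact hx (hG.eq_one_of_zpow hi0 (by simpa using hij))
    simp [h5]

theorem IsTorsionFreeGroup.eq_one_of_pow {G : Type*} [Group G] (hG : IsTorsionFreeGroup G)
    {g : G} (n : ℕ) (hn : n ≠ 0) (h : g ^ n = 1) : g = 1 :=
  hG.eq_one_of_zpow (n := n) (by exact_mod_cast hn) (by simpa using h)

/-! ### Displacements of two-step paths -/

/-- The path with ends `g`, `g'` given by `a g = b p` and `c p = d g'` has displacement
`s = g' g⁻¹`. -/
def TwoStep {G : Type*} [Group G] (a b c d s : G) : Prop :=
  d⁻¹ * c * b⁻¹ * a = s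

theorem TwoStep.reverse {G : Type*} [Group G] {a b c d s : G} (h : TwoStep a b c d s) :
    TwoStep d c b a s⁻¹ := by
  rw [TwoStep] at *
  rw [← h]; group

theorem TwoStep.of_links {G : Type*} [Group G] {a b c d g p g' : G} (h : a * g = b * p)
    (h' : c * p = d * g') : TwoStep a b c d (g' * g⁻¹) := by
  have h₁ : a = b * p * g⁻¹ := by rw [← h]; group
  have h₂ : c = d * g' * p⁻¹ := by rw [← h']; group
  rw [TwoStep, h₁, h₂]; group

section Paths

/-! Sets of two-step paths that cannot have the same displacement. Up to permuting the letters and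
reversing the paths, these are the minimal ones; the names list the letters of the paths. -/

variable {G : Type*} [Group G] {u v w s : G}

/-- Change of variables turning the displacements into words in `x = u⁻¹ v`, `y = u⁻¹ w`. -/
theorem exists_eq_mul (u v w : G) : ∃ x y, v = u * x ∧ w = u * y :=
  ⟨u⁻¹ * v, u⁻¹ * w, by simp, by simp⟩

theorem not_twoStep_uvuv_vuvu (hG : IsTorsionFreeGroup G) (hc : ¬ Commute (u⁻¹ * v) (u⁻¹ * w))
    (h₁ : TwoStep u v u v s) (h₂ : TwoStep v u v u s) : False := by
  obtain ⟨x, y, rfl, rfl⟩ := exists_eq_mul u v w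
  simp only [TwoStep, mul_inv_rev, mul_assoc, inv_mul_cancel_left, inv_mul_cancel, mul_one] at *
  have hx : x = 1 := by
    apply hG.eq_one_of_pow 4 (by norm_num)
    calc x ^ 4 = (x * x) * (x * x) := by simp [pow_succ, mul_assoc]
      _ = (x * x) * (x⁻¹ * x⁻¹) := by rw [h₂, h₁]
      _ = 1 := by simp [mul_assoc]
  exact hc (hx ▸ Commute.one_left y)

theorem not_twoStep_uvuw_wuvu (hG : IsTorsionFreeGroup G) (hc : ¬ Commute (u⁻¹ * v) (u⁻¹ * w))
    (h₁ : TwoStep u v u w s) (h₂ : TwoStep w u v u s) : False := by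
  obtain ⟨x, y, rfl, rfl⟩ := exists_eq_mul u v w
  simp only [TwoStep, mul_inv_rev, mul_assoc, inv_mul_cancel_left, inv_mul_cancel, mul_one] at *
  have hxy : x * y = 1 := by
    apply hG.eq_one_of_pow 2 (by norm_num)
    calc (x * y) ^ 2 = (x * y) * (y⁻¹ * x⁻¹) := by rw [pow_two, h₁, h₂]
      _ = 1 := by simp [mul_assoc]
  exact hc (eq_inv_of_mul_eq_one_right hxy ▸ (Commute.refl x).inv_right)

theorem not_twoStep_uvuv_wuvu (hc : ¬ Commute (u⁻¹ * v) (u⁻¹ * w))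
    (h₁ : TwoStep u v u v s) (h₂ : TwoStep w u v u s) : False := by
  obtain ⟨x, y, rfl, rfl⟩ := exists_eq_mul u v w
  simp only [TwoStep, mul_inv_rev, mul_assoc, inv_mul_cancel_left, inv_mul_cancel, mul_one] at *
  have hy : y = x⁻¹ ^ 3 := by
    calc y = x⁻¹ * (x * y) := by simp
      _ = x⁻¹ ^ 3 := by rw [h₂, ← h₁]; simp [pow_succ, mul_assoc]
  exact hc (hy ▸ (Commute.refl x).inv_right.pow_right 3)

theorem not_twoStep_uvuv_vuwu (hc : ¬ Commute (u⁻¹ * v) (u⁻¹ * w))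
    (h₁ : TwoStep u v u v s) (h₂ : TwoStep v u w u s) : False := by
  obtain ⟨x, y, rfl, rfl⟩ := exists_eq_mul u v w
  simp only [TwoStep, mul_inv_rev, mul_assoc, inv_mul_cancel_left, inv_mul_cancel, mul_one] at *
  have hy : y = x⁻¹ ^ 3 := by
    calc y = (y * x) * x⁻¹ := by simp
      _ = x⁻¹ ^ 3 := by rw [h₂, ← h₁]; simp [pow_succ, mul_assoc]
  exact hc (hy ▸ (Commute.refl x).inv_right.pow_right 3)

theorem not_twoStep_uvuv_vuvw (hc : ¬ Commute (u⁻¹ * v) (u⁻¹ * w))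
    (h₁ : TwoStep u v u v s) (h₂ : TwoStep v u v w s) : False := by
  obtain ⟨x, y, rfl, rfl⟩ := exists_eq_mul u v w
  simp only [TwoStep, mul_inv_rev, mul_assoc, inv_mul_cancel_left, inv_mul_cancel, mul_one] at *
  have hy : y = x ^ 4 := by
    calc y = (x * x) * (y⁻¹ * (x * x))⁻¹ := by simp [mul_assoc]
      _ = x ^ 4 := by rw [h₂, ← h₁]; simp [pow_succ, mul_assoc]
  exact hc (hy ▸ (Commute.refl x).pow_right 4)

/-- The equations give y² = x³ and yx⁻¹y⁻¹ = x⁻⁵. Since y commutes with y² = x³, this yields x⁻³ =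
x⁻¹⁵, so x¹² = 1. -/
theorem not_twoStep_uvuv_vwuw_wvwu (hG : IsTorsionFreeGroup G) (hc : ¬ Commute (u⁻¹ * v) (u⁻¹ * w))
    (h₁ : TwoStep u v u v s) (h₂ : TwoStep v w u w s) (h₃ : TwoStep w v w u s) : False := by
  obtain ⟨x, y, rfl, rfl⟩ := exists_eq_mul u v w
  simp only [TwoStep, mul_inv_rev, mul_assoc, inv_mul_cancel_left, inv_mul_cancel, mul_one] at *
  have hyy : y * y = x ^ 3 := by
    calc y * y = x * (y⁻¹ * (y⁻¹ * x))⁻¹ := by simp [mul_assoc]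
      _ = x ^ 3 := by rw [h₂, ← h₁]; simp [pow_succ, mul_assoc]
  have hconj : SemiconjBy y x⁻¹ (x⁻¹ ^ 5) := by
    rw [SemiconjBy]
    calc y * x⁻¹ = y * (x⁻¹ * y) * (y * y)⁻¹ * y := by simp [mul_assoc]
      _ = x⁻¹ ^ 5 * y := by rw [h₃, hyy, ← h₁]; simp [pow_succ, mul_assoc]
  have hcomm : SemiconjBy y (x⁻¹ ^ 3) (x⁻¹ ^ 3) := by
    have : Commute y (y * y) := (Commute.refl y).mul_right (Commute.refl y)
    rw [hyy] at this
    rw [inv_pow]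
    exact this.inv_right
  have hpow : x⁻¹ ^ 12 * x⁻¹ ^ 3 = 1 * x⁻¹ ^ 3 := by
    have := (hconj.pow_right 3).eq.symm.trans hcomm.eq
    rw [one_mul, ← pow_add]
    simpa only [← pow_mul] using mul_right_cancel this
  have hx : x⁻¹ = 1 := hG.eq_one_of_pow 12 (by norm_num) (mul_right_cancel hpow)
  exact hc (inv_eq_one.1 hx ▸ Commute.one_left y)

/-- Here y² = x⁻² and xy⁻¹x⁻¹ = y⁵. As x commutes with y⁻² = x², squaring gives y¹⁰ = y⁻², so y¹² =
1. -/
theorem not_twoStep_uvuv_vwvw_wuwu (hG : IsTorsionFreeGroup G) (hc : ¬ Commute (u⁻¹ * v) (u⁻¹ * w))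
    (h₁ : TwoStep u v u v s) (h₂ : TwoStep v w v w s) (h₃ : TwoStep w u w u s) : False := by
  obtain ⟨x, y, rfl, rfl⟩ := exists_eq_mul u v w
  simp only [TwoStep, mul_inv_rev, mul_assoc, inv_mul_cancel_left, inv_mul_cancel, mul_one] at *
  have hconj : SemiconjBy x y⁻¹ (y ^ 5) := by
    rw [SemiconjBy]
    calc x * y⁻¹ = y * (y⁻¹ * (x * (y⁻¹ * x))) * (x⁻¹ * x⁻¹) * x := by simp [mul_assoc]
      _ = y ^ 5 * x := by rw [h₂, h₁, ← h₃]; simp [pow_succ, mul_assoc]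
  have hcomm : SemiconjBy x (y⁻¹ ^ 2) (y⁻¹ ^ 2) := by
    have hyy : y⁻¹ ^ 2 = x ^ 2 := by
      rw [inv_pow, pow_two, h₃, ← h₁]; simp [pow_two]
    rw [hyy]
    exact (Commute.refl x).pow_right 2
  have hpow : y ^ 12 = 1 := by
    have h : (y ^ 5) ^ 2 = y⁻¹ ^ 2 :=
      mul_right_cancel ((hconj.pow_right 2).eq.symm.trans hcomm.eq)
    calc y ^ 12 = (y ^ 5) ^ 2 * y ^ 2 := by rw [← pow_mul, ← pow_add]
      _ = 1 := by rw [h, inv_pow, inv_mul_cancel]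
  exact hc (hG.eq_one_of_pow 12 (by norm_num) hpow ▸ Commute.one_right x)

theorem not_twoStep_uvuw_vuwu_wuwv (hc : ¬ Commute (u⁻¹ * v) (u⁻¹ * w))
    (h₁ : TwoStep u v u w s) (h₂ : TwoStep v u w u s) (h₃ : TwoStep w u w v s) : False := by
  obtain ⟨x, y, rfl, rfl⟩ := exists_eq_mul u v w
  simp only [TwoStep, mul_inv_rev, mul_assoc, inv_mul_cancel_left, inv_mul_cancel, mul_one] at *
  have hyy : y * y = x⁻¹ * x⁻¹ := by
    calc y * y = x⁻¹ * (y⁻¹ * x⁻¹)⁻¹ * y := by simp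
      _ = x⁻¹ * x⁻¹ := by rw [h₁, ← h₂]; simp [mul_assoc]
  have hy : y = x⁻¹ ^ 4 := by
    calc y = (y * x) * x⁻¹ := by simp
      _ = x⁻¹ ^ 4 := by rw [h₂, ← h₃, hyy]; simp [pow_succ, mul_assoc]
  exact hc (hy ▸ (Commute.refl x).inv_right.pow_right 4)

theorem not_twoStep_uvuw_vuwv_wvwu (hc : ¬ Commute (u⁻¹ * v) (u⁻¹ * w))
    (h₁ : TwoStep u v u w s) (h₂ : TwoStep v u w v s) (h₃ : TwoStep w v w u s) : False := by
  obtain ⟨x, y, rfl, rfl⟩ := exists_eq_mul u v w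
  simp only [TwoStep, mul_inv_rev, mul_assoc, inv_mul_cancel_left, inv_mul_cancel, mul_one] at *
  have hyxy : y * (x⁻¹ * y) = x⁻¹ * x⁻¹ := by
    calc y * (x⁻¹ * y) = x⁻¹ * (y⁻¹ * x⁻¹)⁻¹ * (x⁻¹ * (y * x)) * x⁻¹ := by simp [mul_assoc]
      _ = x⁻¹ * x⁻¹ := by rw [h₁, h₂]; simp
  have hy : y = x := by
    rw [h₃, ← h₁] at hyxy
    exact inv_injective (mul_right_cancel hyxy)
  exact hc (hy ▸ Commute.refl y)

/-- The relations yxy⁻¹ = x⁻² and xyx⁻¹ = y⁻² evaluate the commutator of x and y both as x³ and as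
y⁻³. So y commutes with x³, whence x⁻⁶ = x³ and x⁹ = 1. -/
theorem not_twoStep_uvuw_vwvu_wuwv (hG : IsTorsionFreeGroup G) (hc : ¬ Commute (u⁻¹ * v) (u⁻¹ * w))
    (h₁ : TwoStep u v u w s) (h₂ : TwoStep v w v u s) (h₃ : TwoStep w u w v s) : False := by
  obtain ⟨x, y, rfl, rfl⟩ := exists_eq_mul u v w
  simp only [TwoStep, mul_inv_rev, mul_assoc, inv_mul_cancel_left, inv_mul_cancel, mul_one] at *
  have hconj : SemiconjBy y x (x⁻¹ * x⁻¹) := by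
    rw [SemiconjBy]
    calc y * x = x⁻¹ * (y⁻¹ * x⁻¹)⁻¹ * (x * (y⁻¹ * x)) * x⁻¹ * y := by simp [mul_assoc]
      _ = x⁻¹ * x⁻¹ * y := by rw [h₁, h₂]; simp
  have hconj' : x * y = y⁻¹ * y⁻¹ * x := by
    calc x * y = (y⁻¹ * x⁻¹)⁻¹ * (x⁻¹ * (y * y)) * (y⁻¹ * y⁻¹ * x) := by simp [mul_assoc]
      _ = y⁻¹ * y⁻¹ * x := by rw [h₁, h₃]; simp
  have hcube : x ^ 3 = y⁻¹ ^ 3 := by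
    calc x ^ 3 = x * (x⁻¹ * x⁻¹ * y * y⁻¹)⁻¹ := by simp [pow_succ, mul_assoc]
      _ = x * y * x⁻¹ * y⁻¹ := by rw [← hconj.eq]; simp [mul_assoc]
      _ = y⁻¹ ^ 3 := by rw [hconj']; simp [pow_succ, mul_assoc]
  have hcomm : SemiconjBy y (x ^ 3) (x ^ 3) := by
    rw [hcube]
    exact (Commute.refl y).inv_right.pow_right 3
  have hpow : x ^ 9 = 1 := by
    have h : (x⁻¹ * x⁻¹) ^ 3 = x ^ 3 :=
      mul_right_cancel ((hconj.pow_right 3).eq.symm.trans hcomm.eq)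
    calc x ^ 9 = x ^ 6 * x ^ 3 := by rw [← pow_add]
      _ = 1 := by rw [← h]; simp [pow_succ, mul_assoc]
  exact hc (hG.eq_one_of_pow 9 (by norm_num) hpow ▸ Commute.one_left y)

theorem not_twoStep_uvwu_vuwv_wuvw (hc : ¬ Commute (u⁻¹ * v) (u⁻¹ * w))
    (h₁ : TwoStep u v w u s) (h₂ : TwoStep v u w v s) (h₃ : TwoStep w u v w s) : False := by
  obtain ⟨x, y, rfl, rfl⟩ := exists_eq_mul u v w
  simp only [TwoStep, mul_inv_rev, mul_assoc, inv_mul_cancel_left, inv_mul_cancel, mul_one] at *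
  have hxy : x * y = y * x * x := by
    calc x * y = x * (y * x⁻¹) * x := by simp [mul_assoc]
      _ = y * x * x := by rw [h₁, ← h₂]; simp [mul_assoc]
  have hy : y = x ^ 3 := by
    calc y = y⁻¹ * (y * (y * x⁻¹)) * x := by simp
      _ = x ^ 3 := by rw [h₁, ← h₃, mul_inv_cancel_left, hxy]; simp [pow_succ, mul_assoc]
  exact hc (hy ▸ (Commute.refl x).pow_right 3)

/-- The relations x² = yxy and y² = xyx make x³ = y³ central in ⟨x, y⟩. For t = y⁻¹x the first
becomes the braid relation tyt = yty, and the symmetry it provides leads to t = y³ty³, so y⁶ = 1. -/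
theorem not_twoStep_uvwu_vwuv_wuvw (hG : IsTorsionFreeGroup G) (hc : ¬ Commute (u⁻¹ * v) (u⁻¹ * w))
    (h₁ : TwoStep u v w u s) (h₂ : TwoStep v w u v s) (h₃ : TwoStep w u v w s) : False := by
  obtain ⟨x, y, rfl, rfl⟩ := exists_eq_mul u v w
  simp only [TwoStep, mul_inv_rev, mul_assoc, inv_mul_cancel_left, inv_mul_cancel, mul_one] at *
  have hyxy : x * x = y * x * y := by
    calc x * x = y * x * (x⁻¹ * (y⁻¹ * x)) * x := by simp [mul_assoc]
      _ = y * x * y := by rw [h₂, ← h₁]; simp [mul_assoc]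
  have hxyx : y * y = x * y * x := by
    calc y * y = y * (y * x⁻¹) * x := by simp [mul_assoc]
      _ = x * y * x := by rw [h₁, ← h₃]; simp [mul_assoc]
  have hcube : x ^ 3 = y ^ 3 := by
    calc x ^ 3 = x * (x * x) := by simp [pow_succ, mul_assoc]
      _ = x * y * x * y := by rw [hyxy]; simp [mul_assoc]
      _ = y ^ 3 := by rw [← hxyx]; simp [pow_succ]
  obtain ⟨t, rfl⟩ : ∃ t, x = y * t := ⟨y⁻¹ * x, by simp⟩
  have hbraid : t * y * t = y * t * y := by
    simpa only [mul_assoc, mul_right_inj] using hyxy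
  have hy : y = t * y * y * t := by
    simpa only [mul_assoc, mul_right_inj] using hxyx
  have hyy : y * y = t * t * y * t * t := by
    calc y * y = y * (t * y * y * t) := by rw [← hy]
      _ = (y * t * y) * y * t := by simp only [mul_assoc]
      _ = (t * y * t) * y * t := by rw [← hbraid]
      _ = t * (y * t * y) * t := by simp only [mul_assoc]
      _ = t * t * y * t * t := by rw [← hbraid]; simp only [mul_assoc]
  have hconj : y = t ^ 3 * y * t ^ 3 := by
    calc y = t * (y * y) * t := by rw [← mul_assoc]; exact hy
      _ = t ^ 3 * y * t ^ 3 := by rw [hyy]; simp [pow_succ, mul_assoc]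
  -- The Garside element `t * y * t` of the braid relation interchanges `t` and `y`; conjugation by
  -- it carries `hconj` to `hconj'`.
  have hΔt : SemiconjBy (t * y * t) t y := by
    rw [SemiconjBy]
    nth_rw 1 [hbraid]
    simp only [mul_assoc]
  have hΔy : SemiconjBy (t * y * t) y t := by
    rw [SemiconjBy]
    nth_rw 2 [hbraid]
    simp only [mul_assoc]
  have hconj' : t = y ^ 3 * t * y ^ 3 := by
    have h := ((hΔt.pow_right 3).mul_right hΔy).mul_right (hΔt.pow_right 3)
    rw [← hconj] at h
    exact mul_right_cancel (hΔy.eq.symm.trans h.eq)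
  have hcomm : Commute t (y ^ 3) := by
    have h : Commute (y * t) (y ^ 3) := hcube ▸ (Commute.refl _).pow_right 3
    have h' : Commute y (y ^ 3) := (Commute.refl _).pow_right 3
    simpa using h'.inv_left.mul_left h
  have hpow : y ^ 6 = 1 := by
    rw [mul_assoc, hcomm.eq, ← mul_assoc, ← pow_add] at hconj'
    exact (mul_eq_right.1 hconj'.symm)
  exact hc (hG.eq_one_of_pow 6 (by norm_num) hpow ▸ Commute.one_right _)

end Paths

/-! ### Rigid triples and triangles -/

/-- A three-element subset of a torsion-free group whose quotients `a⁻¹ b`, `a⁻¹ c` neither commute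
nor invert each other. -/
structure IsRigidTriple {G : Type*} [Group G] (T : Finset G) : Prop where
  torsionFree : IsTorsionFreeGroup G
  card_eq : T.card = 3
  not_commute : ∀ a ∈ T, ∀ b ∈ T, ∀ c ∈ T, a ≠ b → a ≠ c → b ≠ c →
    ¬ Commute (a⁻¹ * b) (a⁻¹ * c)
  not_inverts : ∀ a ∈ T, ∀ b ∈ T, ∀ c ∈ T, a ≠ b → a ≠ c → b ≠ c →
    (a⁻¹ * b) * (a⁻¹ * c) * (a⁻¹ * b)⁻¹ ≠ (a⁻¹ * c)⁻¹

/-- `g` and `g'` are linked if `a g = b g'` for some `a, b ∈ T`. -/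
def Linked {G : Type*} [Group G] (T : Finset G) (g g' : G) : Prop :=
  ∃ a ∈ T, ∃ b ∈ T, a * g = b * g'

theorem Linked.symm {G : Type*} [Group G] {T : Finset G} {g g' : G} (h : Linked T g g') :
    Linked T g' g := by
  obtain ⟨a, ha, b, hb, h⟩ := h
  exact ⟨b, hb, a, ha, h.symm⟩

namespace IsRigidTriple

variable {G : Type*} [Group G] {T : Finset G}

theorem exists_third (hT : IsRigidTriple T) {u v : G} (hu : u ∈ T) (hv : v ∈ T) (huv : u ≠ v) :
    ∃ w ∈ T, u ≠ w ∧ v ≠ w ∧ ∀ z ∈ T, u = z ∨ v = z ∨ w = z := by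
  classical
  have hcard : ((T.erase u).erase v).card = 1 := by
    rw [Finset.card_erase_of_mem (by simp [hv, huv.symm]), Finset.card_erase_of_mem hu, hT.card_eq]
  obtain ⟨w, hw⟩ := Finset.card_eq_one.1 hcard
  have hmem : ∀ z, (z ≠ v ∧ z ≠ u ∧ z ∈ T) ↔ z = w := by
    intro z
    rw [← Finset.mem_singleton, ← hw]
    simp
  obtain ⟨h₁, h₂, h₃⟩ := (hmem w).2 rfl
  refine ⟨w, h₃, h₂.symm, h₁.symm, fun z hz => ?_⟩
  by_contra! hcon
  exact hcon.2.2 ((hmem z).1 ⟨hcon.2.1.symm, hcon.1.symm, hz⟩).symm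

/-- The quotient `b⁻¹ a` determines the pair `a ≠ b` of elements of `T`. -/
theorem pair_unique (hT : IsRigidTriple T) {a b a' b' : G} (ha : a ∈ T) (hb : b ∈ T)
    (ha' : a' ∈ T) (hb' : b' ∈ T) (hab : a ≠ b) (h : b⁻¹ * a = b'⁻¹ * a') : a = a' ∧ b = b' := by
  have hab' : a' ≠ b' := by
    rintro rfl
    exact hab (by simpa [inv_mul_eq_one, eq_comm] using h)
  obtain ⟨w, hw, haw, hbw, hall⟩ := hT.exists_third ha hb hab
  have hc := hT.not_commute a ha b hb w hw hab haw hbw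
  obtain ⟨x, y, rfl, rfl⟩ := exists_eq_mul a b w
  simp only [inv_mul_cancel_left] at hc
  -- Equating x⁻¹ with a quotient of another pair gives x = y, x² = 1, y = x², y = x⁻¹ or y = 1, all
  -- excluded.
  rcases hall a' ha' with rfl | rfl | rfl <;> rcases hall b' hb' with rfl | rfl | rfl <;>
    simp [mul_assoc] at h hab hab' haw hbw ⊢
  · exact h
  · exact hT.torsionFree.eq_one_of_pow 2 (by norm_num) (by
      rw [pow_two]; nth_rw 1 [← h]; simp)
  · refine absurd ?_ hc
    have hy : y = x ^ 2 := by
      calc y = x * (y⁻¹ * x)⁻¹ := by simp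
        _ = x ^ 2 := by rw [← h, inv_inv, pow_two]
    exact hy ▸ (Commute.refl x).pow_right 2
  · exact absurd (h ▸ (Commute.refl x).inv_right) hc
  · exact h

/-- Every triangle comes from an equality `a g = b p = c q` with distinct `a, b, c ∈ T`. -/
theorem triangle (hT : IsRigidTriple T) {g p q : G} (hgp : g ≠ p) (hpq : p ≠ q) (hgq : g ≠ q)
    (h₁ : Linked T g p) (h₂ : Linked T p q) (h₃ : Linked T q g) :
    ∃ a ∈ T, ∃ b ∈ T, ∃ c ∈ T, a ≠ b ∧ a ≠ c ∧ b ≠ c ∧ a * g = b * p ∧ a * g = c * q := by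
  have hne : ∀ {a b g g' : G}, g ≠ g' → a * g = b * g' → a ≠ b := by
    rintro a _ g g' hg h rfl
    exact hg (mul_left_cancel h)
  obtain ⟨a, ha, b, hb, hab⟩ := h₁
  obtain ⟨c, hc, d, hd, hcd⟩ := h₂
  obtain ⟨e, he, f, hf, hef⟩ := h₃
  have ab := hne hgp hab
  have cd := hne hpq hcd
  have ef := hne hgq.symm hef
  -- If the two letters at one vertex agree, the two edge equations there chain into the required
  -- double equality.
  by_cases hbc : b = c
  · subst hbc
    exact ⟨a, ha, b, hb, d, hd, ab, hne hgq (hab.trans hcd), cd, hab, hab.trans hcd⟩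
  by_cases hde : d = e
  · subst hde
    exact ⟨f, hf, c, hc, d, hd, (hne hgp (hef.symm.trans hcd.symm)), ef.symm, cd,
      hef.symm.trans hcd.symm, hef.symm⟩
  by_cases hfa : f = a
  · subst hfa
    exact ⟨f, hf, b, hb, e, he, ab, ef.symm, hne hpq (hab.symm.trans hef.symm), hab, hef.symm⟩
  exfalso
  obtain ⟨w, hw, haw, hbw, hall⟩ := hT.exists_third ha hb ab
  have hword : f⁻¹ * e * d⁻¹ * c * b⁻¹ * a = 1 := by
    have h1 : a = b * p * g⁻¹ := by rw [← hab]; group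
    have h2 : c = d * q * p⁻¹ := by rw [← hcd]; group
    have h3 : e = f * g * q⁻¹ := by rw [← hef]; group
    rw [h1, h2, h3]; group
  have hnc := hT.not_commute a ha b hb w hw ab haw hbw
  have hni₁ := hT.not_inverts a ha b hb w hw ab haw hbw
  have hni₂ := hT.not_inverts a ha w hw b hb haw ab hbw.symm
  have hni₃ := hT.not_inverts b hb a ha w hw ab.symm hbw haw
  have htf := hT.torsionFree
  clear hab hcd hef
  obtain ⟨x, y, rfl, rfl⟩ := exists_eq_mul a b w
  -- Cyclically adjacent letters now differ, so the word is a proper 3-colouring of a hexagon. With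
  -- `a` and `b` fixed, eleven words remain.
  rcases hall c hc with rfl | rfl | rfl <;> rcases hall d hd with rfl | rfl | rfl <;>
    first | exact absurd rfl cd | exact absurd rfl hbc | skip
  all_goals rcases hall e he with rfl | rfl | rfl <;> first | exact absurd rfl hde | skip
  all_goals rcases hall f hf with rfl | rfl | rfl <;>
    first | exact absurd rfl ef | exact absurd rfl hfa | skip
  all_goals
    clear hall ha hb hc hd he hf hw hT cd hbc hde hfa ef
    simp only [mul_inv_rev, mul_assoc, inv_mul_cancel_left, inv_mul_cancel, mul_one,
      inv_inv] at hword hnc hni₁ hni₂ hni₃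
  · refine hnc (htf.eq_one_of_pow (g := x) 3 (by norm_num) ?_ ▸ Commute.one_left y)
    rw [← inv_inj, inv_one, ← hword]
    simp [pow_succ, mul_assoc]
  · have hy : y = x⁻¹ ^ 2 := by
      rw [← mul_one y, ← hword]; simp [pow_succ]
    exact hnc (hy ▸ (Commute.refl x).inv_right.pow_right 2)
  · have hy : y = x ^ 3 := by
      calc y = x * (x⁻¹ * (y * (x⁻¹ * x⁻¹))) * (x * x) := by simp [mul_assoc]
        _ = x ^ 3 := by rw [hword]; simp [pow_succ, mul_assoc]
    exact hnc (hy ▸ (Commute.refl x).pow_right 3)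
  · have hy : y = x⁻¹ ^ 2 := by
      calc y = x⁻¹ * (x⁻¹ * (y⁻¹ * x⁻¹))⁻¹ * x⁻¹ := by simp [mul_assoc]
        _ = x⁻¹ ^ 2 := by rw [hword]; simp [pow_succ]
    exact hnc (hy ▸ (Commute.refl x).inv_right.pow_right 2)
  · have hx : x = y⁻¹ ^ 2 := by
      calc x = (y⁻¹ * (y⁻¹ * x⁻¹))⁻¹ * (y⁻¹ * y⁻¹) := by simp [mul_assoc]
        _ = y⁻¹ ^ 2 := by rw [hword]; simp [pow_succ]
    exact hnc (hx ▸ (Commute.refl y).inv_left.pow_left 2)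
  · apply hni₁
    calc x * (y * x⁻¹) = (y⁻¹ * (x * (y⁻¹ * x⁻¹)))⁻¹ * y⁻¹ := by simp [mul_assoc]
      _ = y⁻¹ := by rw [hword]; simp
  · apply hnc
    calc x * y = y * (y⁻¹ * (x * (y * x⁻¹))) * x := by simp [mul_assoc]
      _ = y * x := by rw [hword, mul_one]
  -- The relation y² = x² presents the Klein bottle group: x⁻¹ = b⁻¹a inverts x⁻¹y = b⁻¹w.
  · have hyy : y * y = x * x := by
      calc y * y = x * (x⁻¹ * (y * (y * x⁻¹))) * x := by simp [mul_assoc]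
        _ = x * x := by rw [hword, mul_one]
    apply hni₃
    calc x⁻¹ * (x⁻¹ * (y * x)) = (x * x)⁻¹ * (y * x) := by simp [mul_assoc]
      _ = y⁻¹ * x := by rw [← hyy]; simp [mul_assoc]
  · have hy : y = x ^ 3 := by
      calc y = (x * x) * (x⁻¹ * (x⁻¹ * (y * x⁻¹))) * x := by simp [mul_assoc]
        _ = x ^ 3 := by rw [hword]; simp [pow_succ]
    exact hnc (hy ▸ (Commute.refl x).pow_right 3)
  · apply hni₂
    calc y * (x * y⁻¹) = (y * (y⁻¹ * (x⁻¹ * (y * x⁻¹))) * y⁻¹)⁻¹ * x⁻¹ := by simp [mul_assoc]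
      _ = x⁻¹ := by rw [hword]; simp
  · obtain ⟨t, rfl⟩ : ∃ t, y = x * t := ⟨x⁻¹ * y, by simp⟩
    have hx : x = t ^ 2 := by
      calc x = (x⁻¹ * (x * t * (x⁻¹ * (x * t * x⁻¹)))) * x := by rw [hword, one_mul]
        _ = t ^ 2 := by simp [pow_two, mul_assoc]
    have hcomm : Commute x t := hx ▸ (Commute.refl t).pow_left 2
    exact hnc ((Commute.refl x).mul_right hcomm)

/-- Two triangles with a common edge have the same third vertex. -/
theorem eq_of_two_triangles (hT : IsRigidTriple T) {g p q q' : G} (hgp : g ≠ p)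
    (hgq : g ≠ q) (hpq : p ≠ q) (hgq' : g ≠ q') (hpq' : p ≠ q') (h₀ : Linked T g p)
    (h₁ : Linked T g q) (h₂ : Linked T p q) (h₁' : Linked T g q') (h₂' : Linked T p q') :
    q = q' := by
  obtain ⟨a, ha, b, hb, c, hc, hab, hac, hbc, e₁, e₂⟩ :=
    hT.triangle hgp hpq hgq h₀ h₂ h₁.symm
  obtain ⟨a', ha', b', hb', c', hc', hab', hac', hbc', e₁', e₂'⟩ :=
    hT.triangle hgp hpq' hgq' h₀ h₂' h₁'.symm
  -- Both letter pairs on the common edge have quotient `p * g⁻¹`.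
  obtain ⟨rfl, rfl⟩ := hT.pair_unique ha hb ha' hb' hab (by
    have h : b⁻¹ * a = p * g⁻¹ := by
      rw [inv_mul_eq_iff_eq_mul, ← mul_assoc, ← e₁, mul_inv_cancel_right]
    have h' : b'⁻¹ * a' = p * g⁻¹ := by
      rw [inv_mul_eq_iff_eq_mul, ← mul_assoc, ← e₁', mul_inv_cancel_right]
    rw [h, h'])
  obtain ⟨w, -, -, -, hall⟩ := hT.exists_third ha hb hab
  have hcw : w = c := by
    rcases hall c hc with h | h | h
    exacts [absurd h hac, absurd h hbc, h]
  have hcw' : w = c' := by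
    rcases hall c' hc' with h | h | h
    exacts [absurd h hac', absurd h hbc', h]
  subst hcw
  subst hcw'
  exact mul_left_cancel (e₂.symm.trans e₂')

end IsRigidTriple

/-! ### Three paths with a common displacement -/

set_option maxHeartbeats 4000000 in
/-- No three two-step paths with pairwise distinct first letters and pairwise distinct last letters
have the same displacement. -/
theorem IsRigidTriple.not_three_twoStep {G : Type*} [Group G] {T : Finset G} (hT : IsRigidTriple T)
    {u v w b₁ b₂ b₃ c₁ c₂ c₃ d₁ d₂ d₃ s : G} (hu : u ∈ T) (hv : v ∈ T) (hw : w ∈ T)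
    (huv : u ≠ v) (huw : u ≠ w) (hvw : v ≠ w) (hb₁ : b₁ ∈ T) (hb₂ : b₂ ∈ T) (hb₃ : b₃ ∈ T)
    (hc₁ : c₁ ∈ T) (hc₂ : c₂ ∈ T) (hc₃ : c₃ ∈ T) (hd₁ : d₁ ∈ T) (hd₂ : d₂ ∈ T) (hd₃ : d₃ ∈ T)
    (ub₁ : u ≠ b₁) (vb₂ : v ≠ b₂) (wb₃ : w ≠ b₃) (bc₁ : b₁ ≠ c₁) (bc₂ : b₂ ≠ c₂) (bc₃ : b₃ ≠ c₃)
    (cd₁ : c₁ ≠ d₁) (cd₂ : c₂ ≠ d₂) (cd₃ : c₃ ≠ d₃)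
    (dd₁₂ : d₁ ≠ d₂) (dd₁₃ : d₁ ≠ d₃) (dd₂₃ : d₂ ≠ d₃)
    (p₁ : TwoStep u b₁ c₁ d₁ s) (p₂ : TwoStep v b₂ c₂ d₂ s) (p₃ : TwoStep w b₃ c₃ d₃ s) :
    False := by
  have hG := hT.torsionFree
  have n₁ := hT.not_commute u hu v hv w hw huv huw hvw
  have n₂ := hT.not_commute u hu w hw v hv huw huv hvw.symm
  have n₃ := hT.not_commute v hv u hu w hw huv.symm hvw huw
  have n₄ := hT.not_commute v hv w hw u hu hvw huv.symm huw.symm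
  have n₅ := hT.not_commute w hw u hu v hv huw.symm hvw.symm huv
  have n₆ := hT.not_commute w hw v hv u hu hvw.symm huw.symm huv.symm
  -- The twelve excluded patterns are listed up to permuting letters and reversing paths. Hence the
  -- reversed paths here, and the non-commutation facts for all six orders of the letters.
  have q₁ := p₁.reverse
  have q₂ := p₂.reverse
  have q₃ := p₃.reverse
  have hall : ∀ z ∈ T, u = z ∨ v = z ∨ w = z := by
    obtain ⟨w', -, -, -, hall⟩ := hT.exists_third hu hv huv
    obtain rfl : w' = w := by
      rcases hall w hw with h | h | h
      exacts [absurd h huw, absurd h hvw, h]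
    exact hall
  replace hb₁ := hall _ hb₁
  replace hb₂ := hall _ hb₂
  replace hb₃ := hall _ hb₃
  replace hc₁ := hall _ hc₁
  replace hc₂ := hall _ hc₂
  replace hc₃ := hall _ hc₃
  replace hd₁ := hall _ hd₁
  replace hd₂ := hall _ hd₂
  replace hd₃ := hall _ hd₃
  clear hall hu hv hw hT
  rcases hd₁ with rfl | rfl | rfl <;> rcases hd₂ with rfl | rfl | rfl <;>
    first
    | exact absurd rfl dd₁₂
    | (rcases hd₃ with rfl | rfl | rfl <;>
        first | exact absurd rfl dd₁₃ | exact absurd rfl dd₂₃ | skip)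
  all_goals rcases hb₁ with rfl | rfl | rfl <;> first | exact absurd rfl ub₁ | skip
  all_goals rcases hb₂ with rfl | rfl | rfl <;> first | exact absurd rfl vb₂ | skip
  all_goals rcases hb₃ with rfl | rfl | rfl <;> first | exact absurd rfl wb₃ | skip
  all_goals rcases hc₁ with rfl | rfl | rfl <;>
    first | exact absurd rfl bc₁ | exact absurd rfl cd₁ | skip
  all_goals rcases hc₂ with rfl | rfl | rfl <;>
    first | exact absurd rfl bc₂ | exact absurd rfl cd₂ | skip
  all_goals rcases hc₃ with rfl | rfl | rfl <;>
    first | exact absurd rfl bc₃ | exact absurd rfl cd₃ | skip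
  all_goals clear huv huw hvw ub₁ vb₂ wb₃ bc₁ bc₂ bc₃ cd₁ cd₂ cd₃ dd₁₂ dd₁₃ dd₂₃
  all_goals grind only [not_twoStep_uvuv_vuvu, not_twoStep_uvuw_wuvu, not_twoStep_uvuv_wuvu,
    not_twoStep_uvuv_vuwu, not_twoStep_uvuv_vuvw, not_twoStep_uvuv_vwuw_wvwu,
    not_twoStep_uvuv_vwvw_wuwu, not_twoStep_uvuw_vuwu_wuwv, not_twoStep_uvuw_vuwv_wvwu,
    not_twoStep_uvuw_vwvu_wuwv, not_twoStep_uvwu_vuwv_wuvw, not_twoStep_uvwu_vwuv_wuvw]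

/-- Distinct vertices have at most two common neighbours. -/
theorem IsRigidTriple.not_three_common_neighbours {G : Type*} [Group G] {T : Finset G}
    (hT : IsRigidTriple T) {g g' : G} {p : Fin 3 → G} (hgg' : g ≠ g') (hp : Function.Injective p)
    (hgp : ∀ i, g ≠ p i) (hgp' : ∀ i, g' ≠ p i) (h : ∀ i, Linked T g (p i))
    (h' : ∀ i, Linked T g' (p i)) : False := by
  have hn : ¬ Linked T g g' := fun hl => hp.ne (show (0 : Fin 3) ≠ 1 by decide)
    (hT.eq_of_two_triangles hgg' (hgp 0) (hgp' 0) (hgp 1) (hgp' 1) hl (h 0) (h' 0) (h 1) (h' 1))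
  have hn' : ∀ i j, i ≠ j → ¬ Linked T (p i) (p j) := fun i j hij hl => hgg'
    (hT.eq_of_two_triangles (hp.ne hij) (hgp i).symm (hgp j).symm (hgp' i).symm (hgp' j).symm
      hl (h i).symm (h j).symm (h' i).symm (h' j).symm)
  choose a ha b hb hab using h
  choose d hd c hc hdc using h'
  -- Equal first letters would link two middle vertices, completing two triangles on that edge with
  -- apexes `g` and `g'`.
  have hinj : ∀ i j, i ≠ j → a i ≠ a j := fun i j hij haij =>
    hn' i j hij ⟨b i, hb i, b j, hb j, by rw [← hab, ← hab, haij]⟩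
  have hinj' : ∀ i j, i ≠ j → d i ≠ d j := fun i j hij hdij =>
    hn' i j hij ⟨c i, hc i, c j, hc j, by rw [← hdc, ← hdc, hdij]⟩
  have hne : ∀ i, a i ≠ b i := fun i e => hgp i (mul_left_cancel ((hab i).trans (by rw [e])))
  have hne' : ∀ i, c i ≠ d i := fun i e => hgp' i (mul_left_cancel ((hdc i).trans (by rw [e])))
  have hbc : ∀ i, b i ≠ c i := fun i e =>
    hn ⟨a i, ha i, d i, hd i, by rw [hab, hdc, e]⟩
  have hs : ∀ i, TwoStep (a i) (b i) (c i) (d i) (g' * g⁻¹) := fun i =>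
    TwoStep.of_links (hab i) (hdc i).symm
  exact hT.not_three_twoStep (ha 0) (ha 1) (ha 2) (hinj 0 1 (by decide)) (hinj 0 2 (by decide))
    (hinj 1 2 (by decide)) (hb 0) (hb 1) (hb 2) (hc 0) (hc 1) (hc 2) (hd 0) (hd 1) (hd 2)
    (hne 0) (hne 1) (hne 2) (hbc 0) (hbc 1) (hbc 2) (hne' 0) (hne' 1) (hne' 2)
    (hinj' 0 1 (by decide)) (hinj' 0 2 (by decide)) (hinj' 1 2 (by decide)) (hs 0) (hs 1) (hs 2)

/-! ### From the group algebra to the graphs -/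

/-- If `β ≠ 0` and `α β` has at most one term, the three-element support of `α` is rigid. -/
theorem isRigidTriple_gsupp {F G : Type*} [Field F] [Group G] (hG : IsTorsionFreeGroup G)
    {α β : MonoidAlgebra F G} (hα : (gsupp α).card = 3) (hβ : β ≠ 0)
    (hαβ : ∀ g g' : G, (α * β).coeff g ≠ 0 → (α * β).coeff g' ≠ 0 → g = g') :
    IsRigidTriple (gsupp α) := by
  have hβ' : (gsupp β).Nonempty := by simpa [gsupp, Finsupp.support_nonempty_iff] using hβ
  have hno : ¬ ∃ a ∈ gsupp α, ∃ b ∈ gsupp β, ∃ a' ∈ gsupp α, ∃ b' ∈ gsupp β,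
      UniqueMul (gsupp α) (gsupp β) a b ∧ UniqueMul (gsupp α) (gsupp β) a' b' ∧
        a * b ≠ a' * b' := by
    rintro ⟨a, ha, b, hb, a', ha', b', hb', hu, hu', hne⟩
    refine hne (hαβ _ _ ?_ ?_)
    · rw [MonoidAlgebra.coeff_mul_mul_of_uniqueMul hu]
      exact mul_ne_zero (Finsupp.mem_support_iff.1 ha) (Finsupp.mem_support_iff.1 hb)
    · rw [MonoidAlgebra.coeff_mul_mul_of_uniqueMul hu']
      exact mul_ne_zero (Finsupp.mem_support_iff.1 ha') (Finsupp.mem_support_iff.1 hb')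
  have hmem : ∀ a ∈ gsupp α, ∀ b ∈ gsupp α, ∀ c ∈ gsupp α, a ≠ b → a ≠ c → b ≠ c →
      ∀ z, z ∈ gsupp α ↔ z = a ∨ z = a * (a⁻¹ * b) ∨ z = a * (a⁻¹ * c) := by
    classical
    intro a ha b hb c hc hab hac hbc z
    have hsub : ({a, b, c} : Finset G) = gsupp α := by
      apply Finset.eq_of_subset_of_card_le
      · simp [Finset.insert_subset_iff, ha, hb, hc]
      · rw [hα, Finset.card_eq_three.2 ⟨a, b, c, hab, hac, hbc, rfl⟩]
    rw [← hsub]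
    simp
  refine ⟨hG, hα, fun a ha b hb c hc hab hac hbc hcomm => hno ?_,
    fun a ha b hb c hc hab hac hbc hinv => hno ?_⟩
  · exact hG.exists_two_uniqueMul_of_commute hα hβ' (hmem a ha b hb c hc hab hac hbc)
      (by rwa [Ne, inv_mul_eq_one]) hcomm
  · exact hG.exists_two_uniqueMul_of_inverts hα hβ' (hmem a ha b hb c hc hab hac hbc)
      (by rwa [Ne, inv_mul_eq_one]) (by rwa [Ne, inv_mul_eq_one]) hinv

/-- A subgraph of the graph of `(α, β)` isomorphic to `H` yields an injection of the vertices of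
`H` under which adjacent vertices become linked. -/
theorem HasSubgraphIsoTo.exists_injective {F G W : Type*} [Field F] [Group G]
    {α β : MonoidAlgebra F G} {H : SimpleGraph W} (h : HasSubgraphIsoTo (pairGraph α β) H) :
    ∃ φ : W → G, Function.Injective φ ∧ ∀ i j, H.Adj i j → Linked (gsupp α) (φ i) (φ j) := by
  obtain ⟨K, hK, ⟨Φ⟩⟩ := h
  refine ⟨fun i => (Φ.vertexEquiv.symm ⟨i, Set.mem_univ i⟩ : G), ?_, ?_⟩
  · intro i j hij
    exact congrArg Subtype.val (Φ.vertexEquiv.symm.injective (Subtype.ext hij))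
  · intro i j hij
    have he : s(i, j) ∈ E(Graph.ofSimpleGraph H) := hij
    have hl := (Φ.isLink_iff (Φ.edgeEquiv.symm ⟨s(i, j), he⟩)
      (Φ.vertexEquiv.symm ⟨i, Set.mem_univ i⟩) (Φ.vertexEquiv.symm ⟨j, Set.mem_univ j⟩)).2 (by
        simp only [Equiv.apply_symm_apply]
        exact ⟨rfl, he⟩)
    obtain ⟨a, b, ha, hb, -, -, -, hab, -⟩ := hK.isLink_mono hl
    exact ⟨a, ha, b, hb, hab⟩

theorem IsRigidTriple.not_hasSubgraphIsoTo {F G : Type*} [Field F] [Group G]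
    {α β : MonoidAlgebra F G} (hT : IsRigidTriple (gsupp α)) :
    ¬ HasSubgraphIsoTo (pairGraph α β) twoTriangles ∧
      ¬ HasSubgraphIsoTo (pairGraph α β) K23 := by
  constructor
  · intro h
    obtain ⟨φ, hφ, hadj⟩ := h.exists_injective
    exact hφ.ne (show (2 : Fin 4) ≠ 3 by decide)
      (hT.eq_of_two_triangles (hφ.ne (show (0 : Fin 4) ≠ 1 by decide))
        (hφ.ne (by decide)) (hφ.ne (by decide)) (hφ.ne (by decide)) (hφ.ne (by decide))
        (hadj 0 1 (by simp [twoTriangles])) (hadj 0 2 (by simp [twoTriangles]))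
        (hadj 1 2 (by simp [twoTriangles])) (hadj 0 3 (by simp [twoTriangles]))
        (hadj 1 3 (by simp [twoTriangles])))
  · intro h
    obtain ⟨φ, hφ, hadj⟩ := h.exists_injective
    exact hT.not_three_common_neighbours (g := φ (Sum.inl 0)) (g' := φ (Sum.inl 1))
      (p := fun i => φ (Sum.inr i)) (hφ.ne (by simp)) (hφ.comp Sum.inr_injective)
      (fun i => hφ.ne (by simp)) (fun i => hφ.ne (by simp))
      (fun i => hadj _ _ (by simp)) (fun i => hadj _ _ (by simp))

theorem mainTheorem5 {F G : Type*} [Field F] [Group G] (hG : IsTorsionFreeGroup G) :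
    (∀ α β : MonoidAlgebra F G, α ≠ 0 → β ≠ 0 → (gsupp α).card = 3 → α * β = 0 →
      ¬ HasSubgraphIsoTo (zeroDivisorGraph α β) twoTriangles ∧
      ¬ HasSubgraphIsoTo (zeroDivisorGraph α β) K23) ∧
    (∀ α β : MonoidAlgebra F G, (gsupp α).card = 3 → α * β = 1 →
      (∀ β' : MonoidAlgebra F G, α * β' = 1 → (gsupp β).card ≤ (gsupp β').card) →
      ¬ HasSubgraphIsoTo (unitGraph α β) twoTriangles ∧
      ¬ HasSubgraphIsoTo (unitGraph α β) K23) := by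
  -- Both parts rest on the same fact: the product, being 0 or 1, has at most one term.
  refine ⟨fun α β _ hβ hα h => (isRigidTriple_gsupp hG hα hβ ?_).not_hasSubgraphIsoTo,
    fun α β hα h _ => (isRigidTriple_gsupp (β := β) hG hα ?_ ?_).not_hasSubgraphIsoTo⟩
  · intro g g' hg
    simp [h] at hg
  · rintro rfl
    simp at h
  · have hone : ∀ g : G, (α * β).coeff g ≠ 0 → g = 1 := by
      classical
      intro g hg
      by_contra hne
      rw [h, MonoidAlgebra.one_def] at hg
      exact hg (by simp [Ne.symm hne])
    intro g g' hg hg'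
    rw [hone g hg, hone g' hg']
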